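/- Theorem 2.1. (a) Let $\theta>0$, $\lambda>0$ and $0<\beta<1$, and let $\mu$ be a probability distribution on $(0,\infty)$ (geometric tempered stable) with Laplace transform $$W(s)=\int_{(0,\infty)} e^{-sx}\,\mu(dx)=\frac{1}{1+\theta\big((s+\lambda)^\beta-\lambda^\beta\big)},\qquad s>0.$$ Then $\mu$ has a probability density that is continuous on $(0,\infty)$, and every probability density $f$ of $\mu$ that is continuous or monotone on some interval $(0,\varepsilon)$, $\varepsilon>0$, satisfies $$f(x)\sim\frac{x^{\beta-1}}{\theta\,\Gamma(\beta)}\qquad\text{as }x\to0^+.$$ (b) Let $\theta>0$, $\delta>0$ and $\gamma>0$, and let $\mu$ be a probability distribution on $(0,\infty)$ (geometric inverse Gaussian) with Laplace transform $$W(s)=\int_{(0,\infty)} e^{-sx}\,\mu(dx)=\frac{1}{1+\theta\delta\big(\sqrt{\gamma^2+2s}-\gamma\big)},\qquad s>0.$$ Then $\mu$ has a probability density that is continuous on $(0,\infty)$, and every probability density $f$ of $\mu$ that is continuous or monotone on some interval $(0,\varepsilon)$, $\varepsilon>0$, satisfies $$f(x)\sim\frac{x^{-1/2}}{\theta\delta\sqrt{2\pi}}\qquad\text{as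 }x\to0^+.$$ Here $f\sim g$ as $x\to0^+$ means $f(x)/g(x)\to1$. -/

import Mathlib

open MeasureTheory Set Filter Topology Asymptotics

noncomputable section

/-- The Laplace transform `s ↦ ∫ e^{-s x} μ(dx)` of a measure on the real line. -/
def laplaceTransform (μ : Measure ℝ) (s : ℝ) : ℝ :=
  ∫ x, Real.exp (-(s * x)) ∂μ

/-- `μ` is a probability distribution on `(0, ∞)` whose Laplace transform is `W` on `(0, ∞)`. -/
structure IsPositiveLawWithLaplace (μ : Measure ℝ) (W : ℝ → ℝ) : Prop where
  isProbabilityMeasure : IsProbabilityMeasure μ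
  concentrated : μ (Iic 0) = 0
  laplace_eq : ∀ s : ℝ, 0 < s → laplaceTransform μ s = W s

/-- The Laplace transform of the geometric tempered stable distribution. -/
def geomTemperedStableLaplace (θ lam β : ℝ) (s : ℝ) : ℝ :=
  1 / (1 + θ * ((s + lam) ^ β - lam ^ β))

/-- The Laplace transform of the geometric inverse Gaussian distribution. -/
def geomInvGaussianLaplace (θ δ γ : ℝ) (s : ℝ) : ℝ :=
  1 / (1 + θ * δ * (Real.sqrt (γ ^ 2 + 2 * s) - γ))

/-- `f` is a probability density function of `μ` with respect to Lebesgue measure. -/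
structure IsDensityOf (f : ℝ → ℝ) (μ : Measure ℝ) : Prop where
  measurable : Measurable f
  nonneg : ∀ x, 0 ≤ f x
  eq_withDensity : μ = volume.withDensity (fun x => ENNReal.ofReal (f x))

/-- `f` is continuous, or monotone (in either direction), on some interval `(0, ε)`. A density is
only determined almost everywhere, so pointwise statements need a regular version; all regular
versions of the same density agree near `0`. -/
def RegularNearZero (f : ℝ → ℝ) : Prop :=
  ∃ ε : ℝ, 0 < ε ∧
    (ContinuousOn f (Ioo 0 ε) ∨ MonotoneOn f (Ioo 0 ε) ∨ AntitoneOn f (Ioo 0 ε))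

end

/-!
Up to the factor `1 / c`, with `r = lam ^ β - 1 / c`, the transform
`1 / (1 + c * ((s + lam) ^ β - lam ^ β))` is `1 / (u ^ β - r)` at `u = s + lam`. Expanding it in
powers of `r / u ^ β` and inverting each term shows that it is, for large `s`, the Laplace transform
of the explicit function
`e ^ (-lam x) x ^ (β - 1) E_{β,β}(r x ^ β) / c`, where `E_{β,β}(y) = ∑ y ^ k / Γ (β (k + 1))` is
entire (`integral_exp_mul_mittagLeffler`, `integral_exp_mul_geomStableDensity`). Uniqueness of the
Laplace transform (`MeasureTheory.Measure.ext_of_integral_exp_neg_eq`) identifies the positive part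
of this function as a density of the law (`eq_withDensity_of_integral_exp_neg_eq`). It is continuous
on `(0, ∞)`, and since `E_{β,β}(0) = 1 / Γ β` it behaves like `x ^ (β - 1) / (c Γ β)` at `0`.
Any density that is continuous or monotone near `0` coincides with it there
(`RegularNearZero.eventuallyEq`). The inverse Gaussian case is `β = 1 / 2`.
-/

open ProbabilityTheory

/-! ### The Mittag-Leffler function -/

/-- `Γ p` dominates every `M ^ p` up to a constant: keep only the part of the Gamma integral
beyond `M`. -/
theorem rpow_mul_exp_neg_le_Gamma {p M : ℝ} (hp : 1 ≤ p) (hM : 0 < M) :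
    M ^ (p - 1) * Real.exp (-M) ≤ Real.Gamma p := by
  have hp0 : 0 < p := by linarith
  rw [Real.Gamma_eq_integral hp0, ← integral_exp_neg_Ioi, ← integral_const_mul]
  have hint := Real.GammaIntegral_convergent hp0
  calc ∫ x in Ioi M, M ^ (p - 1) * Real.exp (-x)
      ≤ ∫ x in Ioi M, Real.exp (-x) * x ^ (p - 1) := by
        refine setIntegral_mono_on ((integrableOn_exp_neg_Ioi M).const_mul _)
          (hint.mono_set (Ioi_subset_Ioi hM.le)) measurableSet_Ioi fun x hx => ?_
        have hMx : M ≤ x := le_of_lt hx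
        rw [mul_comm]
        gcongr
    _ ≤ ∫ x in Ioi 0, Real.exp (-x) * x ^ (p - 1) := by
        refine setIntegral_mono_set hint ?_ (Ioi_subset_Ioi hM.le).eventuallyLE
        filter_upwards [ae_restrict_mem measurableSet_Ioi] with x hx
        have : (0 : ℝ) < x := hx
        positivity

theorem summable_pow_div_Gamma {β : ℝ} (hβ : 0 < β) (y : ℝ) :
    Summable fun k : ℕ => y ^ k / Real.Gamma (β * (k + 1)) := by
  -- `A` exceeds `2 |y|`, and `M ^ β = A` makes the bound on `1 / Γ` a multiple of `A ^ (-k)`.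
  set A := 2 * |y| + 1 with hA
  have hA0 : 0 < A := by positivity
  set M := A ^ (1 / β) with hMdef
  have hM : 0 < M := by positivity
  have hMβ : M ^ β = A := by
    rw [hMdef, ← Real.rpow_mul hA0.le, one_div_mul_cancel hβ.ne', Real.rpow_one]
  have hgeo : Summable fun k : ℕ => M ^ (1 - β) * Real.exp M * (|y| / A) ^ k := by
    refine (summable_geometric_of_lt_one (by positivity) ?_).mul_left _
    rw [div_lt_one hA0]
    linarith [abs_nonneg y]
  refine hgeo.of_norm_bounded_eventually_nat ?_
  filter_upwards [eventually_ge_atTop ⌈1 / β⌉₊] with k hk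
  have hk' : 1 / β ≤ k := (Nat.le_ceil _).trans (by exact_mod_cast hk)
  have hp : 1 ≤ β * (k + 1) := by
    rw [div_le_iff₀ hβ] at hk'
    nlinarith
  have hΓ : 0 < Real.Gamma (β * (k + 1)) := Real.Gamma_pos_of_pos (by positivity)
  have hle := rpow_mul_exp_neg_le_Gamma hp hM
  have hpow : M ^ (β * (k + 1) - 1) = A ^ k * (M ^ (1 - β))⁻¹ := by
    rw [← Real.rpow_neg hM.le, ← hMβ, ← Real.rpow_natCast, ← Real.rpow_mul hM.le,
      ← Real.rpow_add hM]
    congr 1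
    ring
  rw [norm_div, norm_pow, Real.norm_eq_abs, Real.norm_of_nonneg hΓ.le, div_le_iff₀ hΓ]
  calc |y| ^ k = M ^ (1 - β) * Real.exp M * (|y| / A) ^ k
        * (M ^ (β * (k + 1) - 1) * Real.exp (-M)) := by
        rw [hpow, Real.exp_neg, div_pow]
        field_simp
    _ ≤ _ := by gcongr

/-- The two-parameter Mittag-Leffler function `E_{β,β}(y) = ∑ y ^ k / Γ (β k + β)`. -/
noncomputable def mittagLeffler (β y : ℝ) : ℝ := ∑' k : ℕ, y ^ k / Real.Gamma (β * (k + 1))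

theorem mittagLeffler_zero (β : ℝ) : mittagLeffler β 0 = 1 / Real.Gamma β := by
  rw [mittagLeffler, tsum_eq_single 0]
  · simp
  · intro k hk
    simp [hk]

theorem continuous_mittagLeffler {β : ℝ} (hβ : 0 < β) : Continuous (mittagLeffler β) := by
  rw [continuous_iff_continuousAt]
  intro y₀
  have hcont : ContinuousOn (mittagLeffler β) (Metric.ball 0 (|y₀| + 1)) := by
    refine continuousOn_tsum (fun k => by fun_prop)
      (summable_pow_div_Gamma hβ (|y₀| + 1)) fun k y hy => ?_
    have hΓ : 0 < Real.Gamma (β * (k + 1)) := Real.Gamma_pos_of_pos (by positivity)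
    rw [norm_div, norm_pow, Real.norm_of_nonneg hΓ.le]
    gcongr
    exact (mem_ball_zero_iff.mp hy).le
  exact hcont.continuousAt (Metric.isOpen_ball.mem_nhds (by simp))

/-- The Laplace transform of `x ^ (β - 1) E_{β,β}(r x ^ β)`, integrated term by term: the series of
integrals is geometric with ratio `r / u ^ β`. -/
theorem integral_exp_mul_mittagLeffler {β u r : ℝ} (hβ : 0 < β) (hu : 0 < u) (hr : |r| < u ^ β) :
    ∫ x in Ioi 0, Real.exp (-(u * x)) * (x ^ (β - 1) * mittagLeffler β (r * x ^ β)) =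
      1 / (u ^ β - r) := by
  have huβ : 0 < u ^ β := by positivity
  have hint (k : ℕ) :
      ∫ x in Ioi 0, x ^ (β * (k + 1) - 1) * Real.exp (-(u * x))
        = (1 / u) ^ (β * (k + 1)) * Real.Gamma (β * (k + 1)) :=
    Real.integral_rpow_mul_exp_neg_mul_Ioi (by positivity) hu
  have hΓ (k : ℕ) : 0 < Real.Gamma (β * (k + 1)) := Real.Gamma_pos_of_pos (by positivity)
  have hpow (k : ℕ) : (1 / u) ^ (β * (k + 1)) = (u ^ β)⁻¹ * (u ^ β)⁻¹ ^ k := by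
    rw [Real.rpow_mul (by positivity), one_div, Real.inv_rpow hu.le, ← pow_succ',
      ← Real.rpow_natCast]
    push_cast
    rfl
  set F : ℕ → ℝ → ℝ := fun k x =>
    r ^ k / Real.Gamma (β * (k + 1)) * (x ^ (β * (k + 1) - 1) * Real.exp (-(u * x))) with hF
  -- A nonzero Bochner integral is not the junk value of a non-integrable function.
  have hFint (k : ℕ) : IntegrableOn (F k) (Ioi 0) := by
    refine Integrable.const_mul (Integrable.of_integral_ne_zero ?_) _
    rw [hint]
    have := hΓ k
    positivity
  have hFnorm (k : ℕ) : ∫ x in Ioi 0, ‖F k x‖ = (u ^ β)⁻¹ * (|r| / u ^ β) ^ k := by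
    have h1 : ∀ x ∈ Ioi (0 : ℝ), ‖F k x‖ = |r| ^ k / Real.Gamma (β * (k + 1)) *
        (x ^ (β * (k + 1) - 1) * Real.exp (-(u * x))) := by
      intro x hx
      have hx : 0 < x := hx
      simp only [hF]
      rw [norm_mul, norm_div, norm_pow, Real.norm_eq_abs, Real.norm_of_nonneg (hΓ k).le,
        Real.norm_of_nonneg (by positivity)]
    rw [setIntegral_congr_fun measurableSet_Ioi h1, integral_const_mul, hint, hpow, div_pow,
      inv_pow]
    have := (hΓ k).ne'
    field_simp
  have hFval (k : ℕ) : ∫ x in Ioi 0, F k x = (u ^ β)⁻¹ * (r / u ^ β) ^ k := by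
    rw [integral_const_mul, hint, hpow, div_pow, inv_pow]
    have := (hΓ k).ne'
    field_simp
  have hsum : Summable fun k : ℕ => ∫ x in Ioi 0, ‖F k x‖ := by
    simp_rw [hFnorm]
    exact (summable_geometric_of_lt_one (by positivity) ((div_lt_one huβ).2 hr)).mul_left _
  have hkey := hasSum_integral_of_summable_integral_norm hFint hsum
  simp_rw [hFval] at hkey
  have hgeo : HasSum (fun k : ℕ => (u ^ β)⁻¹ * (r / u ^ β) ^ k)
      ((u ^ β)⁻¹ * (1 - r / u ^ β)⁻¹) := by
    refine (hasSum_geometric_of_abs_lt_one ?_).mul_left _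
    rw [abs_div, abs_of_pos huβ]
    exact (div_lt_one huβ).2 hr
  have hne : u ^ β - r ≠ 0 := by linarith [le_abs_self r]
  have hval : (u ^ β)⁻¹ * (1 - r / u ^ β)⁻¹ = 1 / (u ^ β - r) := by
    rw [← mul_inv, mul_sub, mul_div_cancel₀ _ huβ.ne', mul_one, one_div]
  rw [← hval, ← hkey.unique hgeo]
  refine setIntegral_congr_fun measurableSet_Ioi fun x hx => ?_
  have hx : 0 < x := hx
  simp only [hF, mittagLeffler]
  rw [← mul_assoc, ← tsum_mul_left]
  refine tsum_congr fun k => ?_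
  have : x ^ (β * (k + 1) - 1) = x ^ (β - 1) * (x ^ β) ^ k := by
    rw [← Real.rpow_natCast, ← Real.rpow_mul hx.le, ← Real.rpow_add hx]
    congr 1
    ring
  rw [this, mul_pow]
  ring

/-! ### Uniqueness of the Laplace transform -/

/-- Two measures on `ℝ`, possibly infinite, with the same finite Laplace transform on a half-line
`(s₀, ∞)` are equal: by analyticity the transforms agree on a complex half-plane, and their values
on a vertical line inside it are the characteristic functions of exponentially tilted measures. -/
theorem MeasureTheory.Measure.ext_of_integral_exp_neg_eq {μ ν : Measure ℝ} {s₀ : ℝ}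
    (hμ : ∀ s, s₀ < s → Integrable (fun x => Real.exp (-(s * x))) μ)
    (hν : ∀ s, s₀ < s → Integrable (fun x => Real.exp (-(s * x))) ν)
    (h : ∀ s, s₀ < s → ∫ x, Real.exp (-(s * x)) ∂μ = ∫ x, Real.exp (-(s * x)) ∂ν) :
    μ = ν := by
  have hsub (ρ : Measure ℝ) (hρ : ∀ s, s₀ < s → Integrable (fun x => Real.exp (-(s * x))) ρ) :
      Iio (-s₀) ⊆ interior (integrableExpSet id ρ) := by
    refine interior_maximal (fun t ht => ?_) isOpen_Iio
    have := hρ (-t) (by linarith [mem_Iio.1 ht])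
    simpa [integrableExpSet] using this
  have han (ρ : Measure ℝ) (hρ : ∀ s, s₀ < s → Integrable (fun x => Real.exp (-(s * x))) ρ) :
      AnalyticOnNhd ℂ (complexMGF id ρ) {z | z.re ∈ Iio (-s₀)} :=
    analyticOnNhd_complexMGF.mono fun z hz => hsub ρ hρ hz
  set t : ℝ := -(s₀ + 1) with ht
  have ht' : t < -s₀ := by linarith
  have heq : EqOn (complexMGF id μ) (complexMGF id ν) {z | z.re ∈ Iio (-s₀)} := by
    refine AnalyticOnNhd.eqOn_of_preconnected_of_frequently_eq (han μ hμ) (han ν hν)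
      ((convex_Iio (-s₀)).linear_preimage Complex.reLm).isPreconnected (z₀ := (t : ℂ))
      (by simpa using ht') ?_
    have hev : ∀ᶠ x : ℝ in 𝓝[≠] t, complexMGF id μ x = complexMGF id ν x := by
      filter_upwards [nhdsWithin_le_nhds (Iio_mem_nhds ht')] with x hx
      rw [complexMGF_ofReal, complexMGF_ofReal, mgf, mgf]
      simpa using h (-x) (by linarith [mem_Iio.1 hx])
    have htend : Tendsto (fun x : ℝ => (x : ℂ)) (𝓝[≠] t) (𝓝[≠] (t : ℂ)) :=
      Complex.continuous_ofReal.continuousAt.continuousWithinAt.tendsto_nhdsWithin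
        fun x hx => by simpa using hx
    exact htend.frequently hev.frequently
  have hmeas : Measurable fun x : ℝ => ENNReal.ofReal (Real.exp (t * x)) := by fun_prop
  have hfin (ρ : Measure ℝ) (hρ : ∀ s, s₀ < s → Integrable (fun x => Real.exp (-(s * x))) ρ) :
      IsFiniteMeasure (ρ.withDensity fun x => ENNReal.ofReal (Real.exp (t * x))) := by
    refine isFiniteMeasure_withDensity_ofReal ?_
    have := hρ (s₀ + 1) (by linarith)
    simpa only [ht, neg_mul] using this.2
  have hchar (ρ : Measure ℝ) (v : ℝ) :
      charFun (ρ.withDensity fun x => ENNReal.ofReal (Real.exp (t * x))) v =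
        complexMGF id ρ (t + v * Complex.I) := by
    rw [charFun_apply_real, integral_withDensity_eq_integral_toReal_smul hmeas (by simp),
      complexMGF]
    refine integral_congr_ae (ae_of_all _ fun x => ?_)
    simp only [ENNReal.toReal_ofReal (Real.exp_pos _).le, id, Complex.real_smul]
    rw [Complex.ofReal_exp, ← Complex.exp_add]
    push_cast
    ring_nf
  have := hfin μ hμ
  have := hfin ν hν
  have htilt : (μ.withDensity fun x => ENNReal.ofReal (Real.exp (t * x))) =
      ν.withDensity fun x => ENNReal.ofReal (Real.exp (t * x)) := by
    refine Measure.ext_of_charFun (funext fun v => ?_)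
    rw [hchar, hchar]
    exact heq (by simpa using ht')
  have hback (ρ : Measure ℝ) : (ρ.withDensity fun x => ENNReal.ofReal (Real.exp (t * x))).withDensity
      (fun x => ENNReal.ofReal (Real.exp (t * x)))⁻¹ = ρ :=
    withDensity_inv_same hmeas (ae_of_all _ fun x => by simp [Real.exp_pos])
      (ae_of_all _ fun x => by simp)
  rw [← hback μ, htilt, hback ν]

/-- A measure whose Laplace transform agrees, far to the right, with that of a function `g` has
density `g⁺`. No sign is assumed of `g`: uniqueness is applied to `μ + g⁻ dx = g⁺ dx`, an identity
of positive measures, and `g⁻ dx` vanishes because its support is null for the right-hand side. -/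
theorem eq_withDensity_of_integral_exp_neg_eq {μ : Measure ℝ} {g : ℝ → ℝ} {s₀ : ℝ}
    (hg : Measurable g)
    (hμ : ∀ s, s₀ < s → Integrable (fun x => Real.exp (-(s * x))) μ)
    (hgi : ∀ s, s₀ < s → Integrable fun x => Real.exp (-(s * x)) * g x)
    (h : ∀ s, s₀ < s → ∫ x, Real.exp (-(s * x)) ∂μ = ∫ x, Real.exp (-(s * x)) * g x) :
    μ = volume.withDensity fun x => ENNReal.ofReal (g x) := by
  have hmeas (f : ℝ → ℝ) (hf : Measurable f) : Measurable fun x => ENNReal.ofReal (f x) := by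
    fun_prop
  have hpos (f : ℝ → ℝ) (s : ℝ) (hf : Integrable fun x => Real.exp (-(s * x)) * f x) :
      Integrable fun x => (ENNReal.ofReal (f x)).toReal * Real.exp (-(s * x)) := by
    refine hf.pos_part.congr (ae_of_all _ fun x => ?_)
    simp only [ENNReal.toReal_ofReal']
    rw [max_mul_of_nonneg _ _ (Real.exp_pos _).le, zero_mul, mul_comm]
  have hdens (f : ℝ → ℝ) (hf : Measurable f) (s : ℝ)
      (hfi : Integrable fun x => Real.exp (-(s * x)) * f x) :
      Integrable (fun x => Real.exp (-(s * x)))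
        (volume.withDensity fun x => ENNReal.ofReal (f x)) := by
    rw [integrable_withDensity_iff_integrable_smul' (hmeas f hf) (by simp)]
    simpa only [smul_eq_mul] using hpos f s hfi
  have hneg (s : ℝ) (hs : s₀ < s) : Integrable fun x => Real.exp (-(s * x)) * (-g) x := by
    simpa using (hgi s hs).neg
  -- All the measures involved are positive, so uniqueness applies to this rearrangement.
  have hsum : μ + volume.withDensity (fun x => ENNReal.ofReal ((-g) x)) =
      volume.withDensity fun x => ENNReal.ofReal (g x) := by
    refine MeasureTheory.Measure.ext_of_integral_exp_neg_eq (s₀ := s₀)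
      (fun s hs => (hμ s hs).add_measure (hdens _ hg.neg s (hneg s hs)))
      (fun s hs => hdens _ hg s (hgi s hs)) fun s hs => ?_
    rw [integral_add_measure (hμ s hs) (hdens _ hg.neg s (hneg s hs)), h s hs,
      integral_withDensity_eq_integral_toReal_smul (hmeas _ hg.neg) (by simp),
      integral_withDensity_eq_integral_toReal_smul (hmeas _ hg) (by simp)]
    simp only [smul_eq_mul]
    rw [← integral_add (hgi s hs) (hpos _ s (hneg s hs))]
    refine integral_congr_ae (ae_of_all _ fun x => ?_)
    simp only [ENNReal.toReal_ofReal', Pi.neg_apply]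
    rcases le_total 0 (g x) with hx | hx
    · rw [max_eq_left hx, max_eq_right (by linarith)]
      ring
    · rw [max_eq_right hx, max_eq_left (by linarith)]
      ring
  have hN : MeasurableSet {x | g x < 0} := measurableSet_lt hg measurable_const
  have hnull : volume.withDensity (fun x => ENNReal.ofReal ((-g) x)) = 0 := by
    rw [← Measure.measure_univ_eq_zero, ← union_compl_self {x | g x < 0}]
    refine measure_union_null (le_antisymm ?_ zero_le) ?_
    · have hle : volume.withDensity (fun x => ENNReal.ofReal ((-g) x)) ≤
          volume.withDensity fun x => ENNReal.ofReal (g x) :=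
        hsum ▸ Measure.le_add_left le_rfl
      refine (hle _).trans_eq ?_
      rw [withDensity_apply _ hN, setLIntegral_congr_fun hN (g := fun _ => 0), lintegral_zero]
      exact fun x hx => ENNReal.ofReal_of_nonpos (le_of_lt hx)
    · rw [withDensity_apply _ hN.compl, setLIntegral_congr_fun hN.compl (g := fun _ => 0),
        lintegral_zero]
      intro x hx
      have hx : 0 ≤ g x := not_lt.1 hx
      exact ENNReal.ofReal_of_nonpos (by simpa using hx)
  rw [← hsum, hnull, add_zero]

/-! ### Regular versions of a density -/

/-- A monotone function is squeezed between nearby values of a continuous function with which it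
agrees on a dense set. -/
theorem MonotoneOn.eqOn_of_ae_eq {f g : ℝ → ℝ} {a b : ℝ} (hf : MonotoneOn f (Ioo a b))
    (hg : ContinuousOn g (Ioo a b)) (h : ∀ᵐ x, x ∈ Ioo a b → f x = g x) :
    EqOn f g (Ioo a b) := by
  have hdense : Dense {x | x ∈ Ioo a b → f x = g x} := Measure.dense_of_ae h
  intro x hx
  have hnhds : ∀ᶠ y in 𝓝 x, y ∈ Ioo a b := Ioo_mem_nhds hx.1 hx.2
  have hgx := hg.continuousAt hnhds
  by_contra hne
  rcases lt_or_gt_of_ne hne with hlt | hlt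
  · obtain ⟨l, hl, hlx⟩ := mem_nhdsLT_iff_exists_Ioo_subset.1 (nhdsWithin_le_nhds
      (hnhds.and (hgx.eventually (lt_mem_nhds hlt))) : _ ∈ 𝓝[<] x)
    obtain ⟨y, hy, hylx⟩ := hdense.exists_between hl
    obtain ⟨hy1, hy2⟩ := hlx hylx
    exact absurd (hf hy1 hx hylx.2.le) (by rw [hy hy1]; exact not_le.2 hy2)
  · obtain ⟨u, hu, hxu⟩ := mem_nhdsGT_iff_exists_Ioo_subset.1 (nhdsWithin_le_nhds
      (hnhds.and (hgx.eventually (gt_mem_nhds hlt))) : _ ∈ 𝓝[>] x)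
    obtain ⟨y, hy, hyxu⟩ := hdense.exists_between hu
    obtain ⟨hy1, hy2⟩ := hxu hyxu
    exact absurd (hf hx hy1 hyxu.1.le) (by rw [hy hy1]; exact not_le.2 hy2)

/-- Regular versions of a density agree near `0` with any version continuous on `(0, ∞)`. -/
theorem RegularNearZero.eventuallyEq {f g : ℝ → ℝ} (hf : RegularNearZero f)
    (hg : ContinuousOn g (Ioi 0)) (h : f =ᵐ[volume] g) : f =ᶠ[𝓝[>] 0] g := by
  obtain ⟨ε, hε, hreg⟩ := hf
  have hgε : ContinuousOn g (Ioo 0 ε) := hg.mono Ioo_subset_Ioi_self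
  suffices EqOn f g (Ioo 0 ε) from this.eventuallyEq_of_mem (Ioo_mem_nhdsGT hε)
  rcases hreg with hc | hm | ha
  · exact Measure.eqOn_open_of_ae_eq (ae_restrict_of_ae h) isOpen_Ioo hc hgε
  · exact hm.eqOn_of_ae_eq hgε (h.mono fun x hx _ => hx)
  · have := MonotoneOn.eqOn_of_ae_eq ha.neg hgε.neg (h.mono fun x hx _ => by simp [hx])
    exact fun x hx => neg_injective (this hx)

/-! ### The explicit density -/

/-- The function on `ℝ`, zero on `(-∞, 0]`, whose Laplace transform is
`s ↦ 1 / (1 + c * ((s + lam) ^ β - lam ^ β))` for large `s`. Its sign is not clear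
from the formula, so its positive part is what is used as a density. -/
noncomputable def geomStableDensity (c lam β : ℝ) : ℝ → ℝ :=
  indicator (Ioi 0) fun x =>
    x ^ (β - 1) * (Real.exp (-(lam * x)) * mittagLeffler β ((lam ^ β - 1 / c) * x ^ β) / c)

section

variable {c lam β : ℝ}

theorem measurable_geomStableDensity (hβ : 0 < β) : Measurable (geomStableDensity c lam β) := by
  have := (continuous_mittagLeffler hβ).measurable
  exact Measurable.indicator (by fun_prop) measurableSet_Ioi

theorem continuousOn_geomStableDensity (hβ : 0 < β) :
    ContinuousOn (geomStableDensity c lam β) (Ioi 0) := by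
  refine ContinuousOn.congr (fun x hx => ContinuousAt.continuousWithinAt ?_)
    (eqOn_indicator (s := Ioi (0 : ℝ)))
  have hx : x ≠ 0 := ne_of_gt hx
  have := continuous_mittagLeffler hβ
  fun_prop (disch := simp [hx])

theorem integral_exp_mul_geomStableDensity (hc : 0 < c) (hlam : 0 < lam) (hβ : 0 < β) {s : ℝ}
    (hs : |lam ^ β - 1 / c| ^ β⁻¹ < s) :
    ∫ x, Real.exp (-(s * x)) * geomStableDensity c lam β x =
      1 / (1 + c * ((s + lam) ^ β - lam ^ β)) := by
  have hs0 : 0 < s := lt_of_le_of_lt (by positivity) hs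
  have hr : |lam ^ β - 1 / c| < (s + lam) ^ β := by
    rw [← Real.rpow_inv_lt_iff_of_pos (abs_nonneg _) (by positivity) hβ]
    linarith
  have hfun : (fun x => Real.exp (-(s * x)) * geomStableDensity c lam β x) =
      indicator (Ioi 0) fun x => Real.exp (-((s + lam) * x)) *
        (x ^ (β - 1) * mittagLeffler β ((lam ^ β - 1 / c) * x ^ β)) / c := by
    funext x
    by_cases hx : x ∈ Ioi (0 : ℝ)
    · rw [geomStableDensity, indicator_of_mem hx, indicator_of_mem hx, add_mul, neg_add,
        Real.exp_add]
      ring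
    · rw [geomStableDensity, indicator_of_notMem hx, indicator_of_notMem hx, mul_zero]
  rw [hfun, integral_indicator measurableSet_Ioi, integral_div,
    integral_exp_mul_mittagLeffler hβ (by positivity) hr, div_div]
  congr 1
  field_simp
  ring

/-- Integrability comes from the value of the integral, which is nonzero. -/
theorem integrable_exp_mul_geomStableDensity (hc : 0 < c) (hlam : 0 < lam) (hβ : 0 < β) {s : ℝ}
    (hs : |lam ^ β - 1 / c| ^ β⁻¹ < s) :
    Integrable fun x => Real.exp (-(s * x)) * geomStableDensity c lam β x := by
  have hs0 : 0 < s := lt_of_le_of_lt (by positivity) hs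
  refine Integrable.of_integral_ne_zero ?_
  rw [integral_exp_mul_geomStableDensity hc hlam hβ hs]
  have : lam ^ β ≤ (s + lam) ^ β := Real.rpow_le_rpow hlam.le (by linarith) hβ.le
  have : 0 ≤ c * ((s + lam) ^ β - lam ^ β) := mul_nonneg hc.le (by linarith)
  positivity

theorem isEquivalent_max_geomStableDensity (hc : 0 < c) (hβ : 0 < β) :
    (fun x => max (geomStableDensity c lam β x) 0) ~[𝓝[>] 0]
      fun x => x ^ (β - 1) / (c * Real.Gamma β) := by
  have hΓ : 0 < Real.Gamma β := Real.Gamma_pos_of_pos hβ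
  set h : ℝ → ℝ := fun x =>
    max (Real.exp (-(lam * x)) * mittagLeffler β ((lam ^ β - 1 / c) * x ^ β) / c) 0 with hh
  have hcont : ContinuousAt h 0 := by
    have := continuous_mittagLeffler hβ
    have hpow : Continuous fun x : ℝ => x ^ β := Real.continuous_rpow_const hβ.le
    fun_prop
  have hlim : Tendsto h (𝓝[>] 0) (𝓝 (c * Real.Gamma β)⁻¹) := by
    have h0 : h 0 = (c * Real.Gamma β)⁻¹ := by
      simp only [hh, mul_zero, neg_zero, Real.exp_zero, Real.zero_rpow hβ.ne',
        mittagLeffler_zero]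
      rw [max_eq_left (by positivity), mul_inv]
      ring
    exact h0 ▸ hcont.tendsto.mono_left nhdsWithin_le_nhds
  have hequiv : (fun x => x ^ (β - 1) * h x) ~[𝓝[>] 0]
      fun x => x ^ (β - 1) * (c * Real.Gamma β)⁻¹ :=
    IsEquivalent.refl.mul ((isEquivalent_const_iff_tendsto (by positivity)).2 hlim)
  refine hequiv.congr_left ?_
  filter_upwards [self_mem_nhdsWithin] with x hx
  have hx0 : (0 : ℝ) < x := hx
  rw [geomStableDensity, indicator_of_mem hx, hh]
  simp only
  rw [mul_max_of_nonneg _ _ (by positivity), mul_zero]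

theorem IsPositiveLawWithLaplace.eq_withDensity_geomStableDensity (hc : 0 < c) (hlam : 0 < lam)
    (hβ : 0 < β) {μ : Measure ℝ}
    (hμ : IsPositiveLawWithLaplace μ fun s => 1 / (1 + c * ((s + lam) ^ β - lam ^ β))) :
    μ = volume.withDensity fun x => ENNReal.ofReal (geomStableDensity c lam β x) := by
  have := hμ.isProbabilityMeasure
  have hpos {s : ℝ} (hs : |lam ^ β - 1 / c| ^ β⁻¹ < s) : 0 < s :=
    lt_of_le_of_lt (by positivity) hs
  refine eq_withDensity_of_integral_exp_neg_eq (measurable_geomStableDensity hβ)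
    (fun s hs => ?_) (fun s hs => integrable_exp_mul_geomStableDensity hc hlam hβ hs)
    (fun s hs => ?_)
  · refine Integrable.of_bound (by fun_prop) 1 ?_
    have hae : ∀ᵐ x ∂μ, ¬ x ∈ Iic 0 := measure_eq_zero_iff_ae_notMem.1 hμ.concentrated
    filter_upwards [hae] with x hx
    have hx : 0 < x := not_le.1 hx
    have hs := hpos hs
    rw [Real.norm_eq_abs, Real.abs_exp, Real.exp_le_one_iff]
    nlinarith [mul_pos hs hx]
  · rw [integral_exp_mul_geomStableDensity hc hlam hβ hs]
    exact hμ.laplace_eq s (hpos hs)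

theorem IsPositiveLawWithLaplace.density_asymptotic (hc : 0 < c) (hlam : 0 < lam)
    (hβ : 0 < β) {μ : Measure ℝ}
    (hμ : IsPositiveLawWithLaplace μ fun s => 1 / (1 + c * ((s + lam) ^ β - lam ^ β))) :
    (∃ f : ℝ → ℝ, IsDensityOf f μ ∧ ContinuousOn f (Ioi 0)) ∧
      ∀ f : ℝ → ℝ, IsDensityOf f μ → RegularNearZero f →
        f ~[𝓝[>] 0] fun x : ℝ => x ^ (β - 1) / (c * Real.Gamma β) := by
  have hcont : ContinuousOn (fun x => max (geomStableDensity c lam β x) 0) (Ioi 0) :=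
    (continuous_id.max continuous_const).comp_continuousOn (continuousOn_geomStableDensity hβ)
  have hdens : IsDensityOf (fun x => max (geomStableDensity c lam β x) 0) μ := by
    refine ⟨(measurable_geomStableDensity hβ).max measurable_const, fun x => le_max_right _ _, ?_⟩
    rw [hμ.eq_withDensity_geomStableDensity hc hlam hβ]
    congr with x
    rw [ENNReal.ofReal_max, ENNReal.ofReal_zero, max_eq_left zero_le]
  refine ⟨⟨_, hdens, hcont⟩, fun f hf hreg => ?_⟩
  have hae : f =ᵐ[volume] fun x => max (geomStableDensity c lam β x) 0 := by
    have h := hf.eq_withDensity.symm.trans hdens.eq_withDensity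
    rw [withDensity_eq_iff_of_sigmaFinite hf.measurable.ennreal_ofReal.aemeasurable
      hdens.measurable.ennreal_ofReal.aemeasurable] at h
    filter_upwards [h] with x hx
    exact (ENNReal.ofReal_eq_ofReal_iff (hf.nonneg x) (hdens.nonneg x)).1 hx
  exact (isEquivalent_max_geomStableDensity hc hβ).congr_left (hreg.eventuallyEq hcont hae).symm

end

/-! ### The geometric inverse Gaussian law -/

/-- The geometric inverse Gaussian law is geometric tempered stable with `β = 1 / 2`,
`λ = γ ^ 2 / 2` and `θ` replaced by `θ δ √2`. -/
theorem geomInvGaussianLaplace_eq {θ δ γ s : ℝ} (hγ : 0 < γ) :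
    geomInvGaussianLaplace θ δ γ s = 1 / (1 + θ * δ * Real.sqrt 2 *
      ((s + γ ^ 2 / 2) ^ (1 / 2 : ℝ) - (γ ^ 2 / 2) ^ (1 / 2 : ℝ))) := by
  have h1 : Real.sqrt 2 * (s + γ ^ 2 / 2) ^ (1 / 2 : ℝ) = Real.sqrt (γ ^ 2 + 2 * s) := by
    rw [← Real.sqrt_eq_rpow, ← Real.sqrt_mul zero_le_two]
    ring_nf
  have h2 : Real.sqrt 2 * (γ ^ 2 / 2) ^ (1 / 2 : ℝ) = γ := by
    rw [← Real.sqrt_eq_rpow, ← Real.sqrt_mul zero_le_two, mul_div_cancel₀ _ two_ne_zero,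
      Real.sqrt_sq hγ.le]
  rw [geomInvGaussianLaplace, mul_assoc (θ * δ), mul_sub (Real.sqrt 2), h1, h2]

theorem theorem2p1 :
    (∀ θ lam β : ℝ, 0 < θ → 0 < lam → 0 < β → β < 1 →
      ∀ μ : Measure ℝ, IsPositiveLawWithLaplace μ (geomTemperedStableLaplace θ lam β) →
        (∃ f : ℝ → ℝ, IsDensityOf f μ ∧ ContinuousOn f (Ioi 0)) ∧
        ∀ f : ℝ → ℝ, IsDensityOf f μ → RegularNearZero f →
          f ~[𝓝[>] 0] fun x : ℝ => x ^ (β - 1) / (θ * Real.Gamma β)) ∧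
    (∀ θ δ γ : ℝ, 0 < θ → 0 < δ → 0 < γ →
      ∀ μ : Measure ℝ, IsPositiveLawWithLaplace μ (geomInvGaussianLaplace θ δ γ) →
        (∃ f : ℝ → ℝ, IsDensityOf f μ ∧ ContinuousOn f (Ioi 0)) ∧
        ∀ f : ℝ → ℝ, IsDensityOf f μ → RegularNearZero f →
          f ~[𝓝[>] 0] fun x : ℝ =>
            x ^ (-(1 / 2) : ℝ) / (θ * δ * Real.sqrt (2 * Real.pi))) := by
  refine ⟨fun θ lam β hθ hlam hβ _ μ hμ => hμ.density_asymptotic hθ hlam hβ,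
    fun θ δ γ hθ hδ hγ μ hμ => ?_⟩
  have hμ' : IsPositiveLawWithLaplace μ fun s => 1 / (1 + θ * δ * Real.sqrt 2 *
      ((s + γ ^ 2 / 2) ^ (1 / 2 : ℝ) - (γ ^ 2 / 2) ^ (1 / 2 : ℝ))) :=
    ⟨hμ.isProbabilityMeasure, hμ.concentrated, fun s hs =>
      (hμ.laplace_eq s hs).trans (geomInvGaussianLaplace_eq hγ)⟩
  have hconst : θ * δ * Real.sqrt 2 * Real.Gamma (1 / 2) = θ * δ * Real.sqrt (2 * Real.pi) := by
    rw [Real.Gamma_one_half_eq, Real.sqrt_mul zero_le_two, mul_assoc]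
  have hexp : (1 / 2 - 1 : ℝ) = -(1 / 2) := by norm_num
  simpa only [hconst, hexp] using
    hμ'.density_asymptotic (by positivity) (by positivity) one_half_pos
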